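/- Let $X$ be a Banach space over $\mathbb{K}=\mathbb{R}$ or $\mathbb{C}$, with unit sphere $S_X=\{x\in X:\|x\|=1\}$, and let $\mathcal{L}(X)$ be the space of bounded linear operators on $X$ with the operator norm. The norm of $X$ is called *uniformly micro-semitransitive* if there is a function $\beta\colon(0,2)\to(0,\infty)$ such that for every $\varepsilon\in(0,2)$ and all $x,y\in S_X$ with $\|x-y\|<\beta(\varepsilon)$ there is $T\in\mathcal{L}(X)$ with $\|T\|=1$, $Tx=y$ and $\|T-\mathrm{Id}\|<\varepsilon$. It is called *micro-transitive* if the group $G$ of surjective linear isometries of $X$, with the operator norm topology, acts micro-transitively on $S_X$, that is, for every $x\in S_X$ and every neighborhood $U$ of $\mathrm{Id}$ in $G$ the set $\{Tx: T\in U\}$ is a neighborhood of $x$ in $S_X$. The space $X$ is *uniformly smooth* if its norm is Fréchet differentiable (as a real function) at every point of $S_X$, uniformly on $S_X$: writing $D_x$ for the derivative at $x$, for every $\varepsilon>0$ there is $\delta>0$ such that $\bigl|\|x+h\|-\|x\|-D_x(h)\bigr|\le\varepsilon\|h\|$ for all $x\in S_X$ and $h\in X$ with $\|h\|<\delta$.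 It is *uniformly convex* if for every $\varepsilon>0$ there is $\delta>0$ such that $\|x+y\|\le 2-\delta$ for all $x,y\in S_X$ with $\|x-y\|\ge\varepsilon$. If the norm of $X$ is uniformly micro-semitransitive, then $X$ is both uniformly smooth and uniformly convex. Moreover, every micro-transitive norm is uniformly micro-semitransitive; in particular, every Banach space with micro-transitive norm is uniformly smooth and uniformly convex. -/

import Mathlib

open Topology

/-- A continuous action of a topological group `G` on a topological space `T` is micro-transitive
if for every `x : T` and every neighborhood `U` of the identity, the set `U x` is a
neighborhood of `x`. -/
def IsMicroTransitiveAction (G T : Type*) [Group G] [TopologicalSpace G] [IsTopologicalGroup G]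
    [TopologicalSpace T] [MulAction G T] [ContinuousSMul G T] : Prop :=
  ∀ x : T, ∀ U ∈ 𝓝 (1 : G), (fun g : G => g • x) '' U ∈ 𝓝 x

namespace IsometryGroup

variable {𝕜 X : Type*} [RCLike 𝕜] [NormedAddCommGroup X] [NormedSpace 𝕜 X]

/-- A surjective linear isometry, as a bounded operator. -/
def toOp (T : X ≃ₗᵢ[𝕜] X) : X →L[𝕜] X := T.toContinuousLinearEquiv.toContinuousLinearMap

@[simp]
theorem toOp_apply (T : X ≃ₗᵢ[𝕜] X) (x : X) : toOp T x = T x := rfl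

/-- The group of surjective linear isometries carries the operator norm topology. -/
instance instTopologicalSpace : TopologicalSpace (X ≃ₗᵢ[𝕜] X) :=
  TopologicalSpace.induced toOp inferInstance

theorem isInducing_toOp : IsInducing (toOp : (X ≃ₗᵢ[𝕜] X) → (X →L[𝕜] X)) := ⟨rfl⟩

theorem continuous_toOp : Continuous (toOp : (X ≃ₗᵢ[𝕜] X) → (X →L[𝕜] X)) :=
  isInducing_toOp.continuous

/-- `‖S⁻¹ - T⁻¹‖ ≤ ‖S - T‖` for surjective isometries `S`, `T`. -/
theorem norm_toOp_inv_sub_le (S T : X ≃ₗᵢ[𝕜] X) :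
    ‖toOp S⁻¹ - toOp T⁻¹‖ ≤ ‖toOp S - toOp T‖ := by
  refine ContinuousLinearMap.opNorm_le_bound _ (norm_nonneg _) fun x => ?_
  have h1 : ‖S⁻¹ x - T⁻¹ x‖ = ‖(toOp S - toOp T) (T⁻¹ x)‖ := by
    have hS : S (S⁻¹ x) = x := S.apply_symm_apply x
    have hT : T (T⁻¹ x) = x := T.apply_symm_apply x
    rw [← S.norm_map (S⁻¹ x - T⁻¹ x), map_sub, hS, sub_apply, toOp_apply,
      toOp_apply, hT, norm_sub_rev]
  have h2 : ‖T⁻¹ x‖ = ‖x‖ := (T⁻¹).norm_map x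
  rw [sub_apply, toOp_apply, toOp_apply, h1, ← h2]
  exact ContinuousLinearMap.le_opNorm _ _

instance instIsTopologicalGroup : IsTopologicalGroup (X ≃ₗᵢ[𝕜] X) where
  continuous_mul := by
    rw [isInducing_toOp.continuous_iff]
    have h : Continuous fun p : (X ≃ₗᵢ[𝕜] X) × (X ≃ₗᵢ[𝕜] X) => (toOp p.1).comp (toOp p.2) :=
      (continuous_toOp.comp continuous_fst).clm_comp (continuous_toOp.comp continuous_snd)
    exact h
  continuous_inv := by
    rw [isInducing_toOp.continuous_iff, continuous_iff_continuousAt]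
    intro T
    have h0 : Filter.Tendsto (fun S : X ≃ₗᵢ[𝕜] X => ‖toOp S - toOp T‖) (𝓝 T) (𝓝 0) :=
      tendsto_iff_norm_sub_tendsto_zero.mp continuous_toOp.continuousAt
    exact tendsto_iff_norm_sub_tendsto_zero.mpr
      (squeeze_zero (fun _ => norm_nonneg _) (fun S => norm_toOp_inv_sub_le S T) h0)

/-- The action of the group of surjective linear isometries on the unit sphere. -/
instance instMulActionSphere : MulAction (X ≃ₗᵢ[𝕜] X) (Metric.sphere (0 : X) 1) where
  smul T x := ⟨T x, by
    rw [mem_sphere_zero_iff_norm, T.norm_map, ← mem_sphere_zero_iff_norm]; exact x.2⟩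
  one_smul _ := rfl
  mul_smul _ _ _ := rfl

@[simp]
theorem coe_smul (T : X ≃ₗᵢ[𝕜] X) (x : Metric.sphere (0 : X) 1) : ((T • x : _) : X) = T x := rfl

instance instContinuousSMulSphere :
    ContinuousSMul (X ≃ₗᵢ[𝕜] X) (Metric.sphere (0 : X) 1) where
  continuous_smul := by
    refine Continuous.subtype_mk (f := fun p : (X ≃ₗᵢ[𝕜] X) × Metric.sphere (0 : X) 1 =>
      toOp p.1 (p.2 : X)) ?_ _
    exact (continuous_toOp.comp continuous_fst).clm_apply
      (continuous_subtype_val.comp continuous_snd)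

end IsometryGroup

/-- The norm of `X` is micro-transitive: the group of surjective linear isometries of `X`, with
the operator norm topology, acts micro-transitively on the unit sphere. -/
def MicroTransitiveNorm (𝕜 X : Type*) [RCLike 𝕜] [NormedAddCommGroup X] [NormedSpace 𝕜 X] :
    Prop :=
  IsMicroTransitiveAction (X ≃ₗᵢ[𝕜] X) (Metric.sphere (0 : X) 1)

/-- The norm of `X` is uniformly micro-semitransitive. -/
def UniformlyMicroSemitransitive (𝕜 X : Type*) [RCLike 𝕜] [NormedAddCommGroup X]
    [NormedSpace 𝕜 X] : Prop :=
  ∃ β : Set.Ioo (0 : ℝ) 2 → ℝ, (∀ ε, 0 < β ε) ∧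
    ∀ ε : Set.Ioo (0 : ℝ) 2, ∀ x y : X, ‖x‖ = 1 → ‖y‖ = 1 → ‖x - y‖ < β ε →
      ∃ T : X →L[𝕜] X, ‖T‖ = 1 ∧ T x = y ∧ ‖T - ContinuousLinearMap.id 𝕜 X‖ < ε

/-- `X` is uniformly smooth: its norm is (real) Fréchet differentiable, uniformly on the unit
sphere. -/
def UniformlySmooth (X : Type*) [NormedAddCommGroup X] [NormedSpace ℝ X] : Prop :=
  (∀ x : X, ‖x‖ = 1 → DifferentiableAt ℝ (fun z : X => ‖z‖) x) ∧
    ∀ ε : ℝ, 0 < ε → ∃ δ : ℝ, 0 < δ ∧ ∀ x : X, ‖x‖ = 1 → ∀ h : X, ‖h‖ < δ →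
      |‖x + h‖ - ‖x‖ - fderiv ℝ (fun z : X => ‖z‖) x h| ≤ ε * ‖h‖

/-!
For a micro-transitive norm on a space of real dimension at least two, orbits of the isometry group
are open, so the group is transitive on the connected unit sphere. A neighbourhood of one point
obtained from micro-transitivity is then moved around the sphere by conjugation, which makes it
uniform.

Assume now that the norm is uniformly micro-semitransitive; only the real structure is used.

*Smoothness.* If `T` is a contraction close to the identity with `T x = y` and `f` supports the ball
at `y`, then `f ∘ T` supports it at `x` and is close to `f`. Together with monotonicity of the
subdifferential of the norm this shows that support functionals are unique
(`HasLocalContractions.support_unique`), and then that they depend uniformly continuously on the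
point, which is uniform smoothness.

*Reflexivity.* By uniform smoothness, two functionals almost attaining their norm at the same vector
are close (`HasLocalContractions.dual_close`). A functional on the dual that is far from `X` would
violate this (`HasLocalContractions.surjective_inclusionInDoubleDual`).

*Convexity.* Composing contractions along paths in the sphere gives, for any unit vectors `x` and
`y`, a contraction `T` with `T x = y` that is bounded below by a universal constant
(`HasLocalContractions.exists_contraction`). Suppose uniform convexity fails. Transporting the bad
segments, every unit vector is almost the midpoint of segments in the ball of length bounded below.
At an extreme point of the ball, which exists by Krein-Milman and reflexivity, the half-segments
must converge weakly to zero. Transporting them again, such weakly null vectors exist at every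
point of the sphere (`HasLocalContractions.exists_step`). Adding them successively produces a
bounded sequence `x n` and functionals `g n` in the dual ball that vanish on `x 0`, ..., `x n` and
are uniformly positive on all later terms. A reflexive space contains no such sequence
(`not_exists_separated_sequence`).
-/

/-! ### Support functionals and uniform smoothness -/

/-- Real form of uniform micro-semitransitivity: nearby unit vectors are related by a contraction
close to the identity. The operator norm is replaced by pointwise bounds. -/
def HasLocalContractions (X : Type*) [NormedAddCommGroup X] [NormedSpace ℝ X] : Prop :=
  ∀ ε : ℝ, 0 < ε → ∃ β : ℝ, 0 < β ∧ ∀ x y : X, ‖x‖ = 1 → ‖y‖ = 1 → ‖x - y‖ < β →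
    ∃ T : X →L[ℝ] X, (∀ v, ‖T v‖ ≤ ‖v‖) ∧ T x = y ∧ ∀ v, ‖T v - v‖ ≤ ε * ‖v‖

theorem UniformlyMicroSemitransitive.hasLocalContractions {𝕜 X : Type*} [RCLike 𝕜]
    [NormedAddCommGroup X] [NormedSpace 𝕜 X] [NormedSpace ℝ X] [IsScalarTower ℝ 𝕜 X]
    (h : UniformlyMicroSemitransitive 𝕜 X) : HasLocalContractions X := by
  intro ε hε
  obtain ⟨β, hβ, H⟩ := h
  have hmem : min ε 1 ∈ Set.Ioo (0 : ℝ) 2 :=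
    ⟨lt_min hε one_pos, (min_le_right _ _).trans_lt one_lt_two⟩
  refine ⟨β ⟨_, hmem⟩, hβ _, fun x y hx hy hxy => ?_⟩
  obtain ⟨T, hT, hTx, hTI⟩ := H _ x y hx hy hxy
  refine ⟨T.restrictScalars ℝ, fun v => ?_, hTx, fun v => ?_⟩
  · simpa [hT] using T.le_opNorm v
  · calc ‖T v - v‖ = ‖(T - ContinuousLinearMap.id 𝕜 X) v‖ := rfl
      _ ≤ ‖T - ContinuousLinearMap.id 𝕜 X‖ * ‖v‖ := ContinuousLinearMap.le_opNorm _ _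
      _ ≤ ε * ‖v‖ := by
        gcongr
        exact hTI.le.trans (min_le_left _ _)

section Smooth

variable {X : Type*} [NormedAddCommGroup X] [NormedSpace ℝ X]

theorem apply_le_norm_of_norm_le_one {f : StrongDual ℝ X} (hf : ‖f‖ ≤ 1) (v : X) : f v ≤ ‖v‖ :=
  (le_abs_self _).trans <| (f.le_opNorm v).trans <|
    (mul_le_mul_of_nonneg_right hf (norm_nonneg v)).trans (one_mul _).le

/-- A support functional at `y` becomes a support functional at a nearby point `x`, and moves only
slightly, when composed with a contraction taking `x` to `y`. -/
theorem HasLocalContractions.exists_support_near (H : HasLocalContractions X) {ε : ℝ}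
    (hε : 0 < ε) : ∃ β : ℝ, 0 < β ∧ ∀ x y : X, ‖x‖ = 1 → ‖y‖ = 1 → ‖x - y‖ < β →
      ∀ f : StrongDual ℝ X, ‖f‖ ≤ 1 → f y = 1 →
        ∃ g : StrongDual ℝ X, ‖g‖ ≤ 1 ∧ g x = 1 ∧ ‖g - f‖ ≤ ε := by
  obtain ⟨β, hβ, h⟩ := H ε hε
  refine ⟨β, hβ, fun x y hx hy hxy f hf hfy => ?_⟩
  obtain ⟨T, hT, hTx, hTI⟩ := h x y hx hy hxy
  refine ⟨f.comp T, ?_, by simp [hTx, hfy], ?_⟩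
  · refine ContinuousLinearMap.opNorm_le_bound _ zero_le_one fun v => ?_
    calc ‖f (T v)‖ ≤ ‖f‖ * ‖T v‖ := f.le_opNorm _
      _ ≤ 1 * ‖v‖ := by gcongr; exact hT v
  · refine ContinuousLinearMap.opNorm_le_bound _ hε.le fun v => ?_
    calc ‖f (T v) - f v‖ = ‖f (T v - v)‖ := by rw [map_sub]
      _ ≤ ‖f‖ * ‖T v - v‖ := f.le_opNorm _
      _ ≤ 1 * (ε * ‖v‖) := by gcongr; exact hTI v
      _ = ε * ‖v‖ := one_mul _

/-- Support functionals are unique. For `t < 0` monotonicity of the subdifferential gives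
`g v ≤ f₂ v` for every support functional `g` at `x + t • v`, and such a `g` can be found
arbitrarily close to `f₁`. -/
theorem HasLocalContractions.support_unique (H : HasLocalContractions X) {x : X} (hx : ‖x‖ = 1)
    {f₁ f₂ : StrongDual ℝ X} (h₁ : ‖f₁‖ ≤ 1) (h₂ : ‖f₂‖ ≤ 1) (hf₁ : f₁ x = 1) (hf₂ : f₂ x = 1) :
    f₁ = f₂ := by
  have key : ∀ {f₁ f₂ : StrongDual ℝ X}, ‖f₁‖ ≤ 1 → ‖f₂‖ ≤ 1 → f₁ x = 1 → f₂ x = 1 →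
      ∀ v, f₁ v ≤ f₂ v := by
    intro f₁ f₂ h₁ h₂ hf₁ hf₂ v
    refine le_of_forall_pos_le_add fun e he => ?_
    obtain ⟨ε, hε, hεv⟩ : ∃ ε : ℝ, 0 < ε ∧ ε * ‖v‖ ≤ e := by
      refine ⟨e / (‖v‖ + 1), by positivity, ?_⟩
      rw [div_mul_eq_mul_div, div_le_iff₀ (by positivity)]
      nlinarith [norm_nonneg v]
    obtain ⟨β, hβ, h⟩ := H.exists_support_near hε
    have hx0 : x ≠ 0 := by rintro rfl; simp at hx
    have hc : ContinuousAt (fun t : ℝ => ‖x + t • v‖⁻¹ • (x + t • v)) 0 := by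
      have : ‖x + (0 : ℝ) • v‖ ≠ 0 := by simp [hx0]
      fun_prop (disch := assumption)
    have hc0 : ContinuousAt (fun t : ℝ => ‖x + t • v‖) 0 := by fun_prop
    have e1 : ∀ᶠ t : ℝ in 𝓝 0, ‖‖x + t • v‖⁻¹ • (x + t • v) - x‖ < β := by
      have := hc.eventually (Metric.ball_mem_nhds _ hβ)
      simpa [hx, dist_eq_norm] using this
    have e2 : ∀ᶠ t : ℝ in 𝓝 0, 0 < ‖x + t • v‖ :=
      hc0.eventually (lt_mem_nhds (by simp [hx0]))
    obtain ⟨t, ⟨ht1, ht2⟩, ht⟩ :=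
      (((e1.and e2).filter_mono (nhdsWithin_le_nhds (s := Set.Iio 0))).and
        self_mem_nhdsWithin).exists
    replace ht : t < 0 := ht
    obtain ⟨g, hg, hgz, hgf⟩ := h _ x (by
      rw [norm_smul, norm_inv, norm_norm, inv_mul_cancel₀ ht2.ne']) hx ht1 f₁ h₁ hf₁
    have hgz' : g (x + t • v) = ‖x + t • v‖ := by
      rw [map_smul, smul_eq_mul] at hgz
      field_simp at hgz
      exact hgz
    have a1 := apply_le_norm_of_norm_le_one h₂ (x + t • v)
    have a2 := apply_le_norm_of_norm_le_one hg x
    rw [← hgz'] at a1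
    simp only [map_add, map_smul, smul_eq_mul, hf₂] at a1
    have a3 : g v ≤ f₂ v := by
      by_contra! hlt
      nlinarith
    have a4 : f₁ v - g v ≤ ε * ‖v‖ := by
      have := (g - f₁).le_of_opNorm_le hgf v
      rw [sub_apply, Real.norm_eq_abs] at this
      linarith [neg_abs_le (g v - f₁ v)]
    linarith
  exact ContinuousLinearMap.ext fun v => le_antisymm (key h₁ h₂ hf₁ hf₂ v) (key h₂ h₁ hf₂ hf₁ v)

/-- The duality map is uniformly continuous on the unit sphere. -/
theorem HasLocalContractions.support_uniformContinuous (H : HasLocalContractions X) {ε : ℝ}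
    (hε : 0 < ε) : ∃ β : ℝ, 0 < β ∧ ∀ x y : X, ‖x‖ = 1 → ‖y‖ = 1 → ‖x - y‖ < β →
      ∀ f g : StrongDual ℝ X, ‖f‖ ≤ 1 → ‖g‖ ≤ 1 → f x = 1 → g y = 1 → ‖g - f‖ ≤ ε := by
  obtain ⟨β, hβ, h⟩ := H.exists_support_near hε
  refine ⟨β, hβ, fun x y hx hy hxy f g hf hg hfx hgy => ?_⟩
  obtain ⟨f', hf', hfx', hd⟩ := h x y hx hy hxy g hg hgy
  rw [H.support_unique hx hf hf' hfx hfx', norm_sub_rev]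
  exact hd

theorem norm_normalize_sub_le {z : X} (hz : z ≠ 0) {x : X} (hx : ‖x‖ = 1) :
    ‖x - ‖z‖⁻¹ • z‖ ≤ 2 * ‖z - x‖ := by
  have h1 : ‖z - ‖z‖⁻¹ • z‖ = |‖z‖ - 1| := by
    have : z - ‖z‖⁻¹ • z = (1 - ‖z‖⁻¹) • z := by rw [sub_smul, one_smul]
    rw [this, norm_smul, Real.norm_eq_abs]
    nth_rewrite 2 [← abs_norm z]
    rw [← abs_mul, sub_mul, one_mul, inv_mul_cancel₀ (norm_ne_zero_iff.mpr hz)]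
  have h2 : |‖z‖ - 1| ≤ ‖z - x‖ := hx ▸ abs_norm_sub_norm_le z x
  calc ‖x - ‖z‖⁻¹ • z‖ ≤ ‖x - z‖ + ‖z - ‖z‖⁻¹ • z‖ := norm_sub_le_norm_sub_add_norm_sub _ _ _
    _ ≤ 2 * ‖z - x‖ := by rw [h1, norm_sub_rev x z]; linarith

/-- Uniform first-order expansion of the norm, with the support functional as derivative. -/
theorem HasLocalContractions.norm_add_sub_le (H : HasLocalContractions X) {ε : ℝ}
    (hε : 0 < ε) : ∃ δ : ℝ, 0 < δ ∧ ∀ x : X, ‖x‖ = 1 → ∀ f : StrongDual ℝ X, ‖f‖ ≤ 1 → f x = 1 →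
      ∀ h : X, ‖h‖ < δ → |‖x + h‖ - ‖x‖ - f h| ≤ ε * ‖h‖ := by
  obtain ⟨β, hβ, hu⟩ := H.support_uniformContinuous hε
  refine ⟨min (β / 2) (1 / 2), by positivity, fun x hx f hf hfx h hh => ?_⟩
  have hz : x + h ≠ 0 := by
    intro h0
    have : ‖h‖ = 1 := by rw [← hx, ← norm_neg x, eq_neg_of_add_eq_zero_right h0]
    linarith [min_le_right (β / 2) (1 / 2)]
  obtain ⟨g, hg, hgz⟩ := exists_dual_vector'' ℝ (x + h)
  simp only [RCLike.ofReal_real_eq_id, id_eq] at hgz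
  have hd : ‖x - ‖x + h‖⁻¹ • (x + h)‖ < β := by
    have := norm_normalize_sub_le hz hx
    rw [add_sub_cancel_left] at this
    linarith [min_le_left (β / 2) (1 / 2)]
  have hn : ‖x + h‖ ≠ 0 := norm_ne_zero_iff.mpr hz
  have hfg := hu x _ hx (by rw [norm_smul, norm_inv, norm_norm, inv_mul_cancel₀ hn]) hd
    f g hf hg hfx (by rw [map_smul, hgz, smul_eq_mul, inv_mul_cancel₀ hn])
  have b1 := apply_le_norm_of_norm_le_one hf (x + h)
  have b2 := apply_le_norm_of_norm_le_one hg x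
  have b3 := (le_abs_self _).trans ((g - f).le_of_opNorm_le hfg h)
  rw [map_add] at b1 hgz
  rw [sub_apply] at b3
  rw [abs_le]
  constructor
  · nlinarith [norm_nonneg h]
  · linarith

theorem HasLocalContractions.uniformlySmooth (H : HasLocalContractions X) : UniformlySmooth X := by
  have hd : ∀ x : X, ‖x‖ = 1 → ∀ f : StrongDual ℝ X, ‖f‖ ≤ 1 → f x = 1 →
      HasFDerivAt (fun z : X => ‖z‖) f x := by
    intro x hx f hf hfx
    rw [hasFDerivAt_iff_isLittleO_nhds_zero, Asymptotics.isLittleO_iff]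
    intro c hc
    obtain ⟨δ, hδ, h⟩ := H.norm_add_sub_le hc
    filter_upwards [Metric.ball_mem_nhds (0 : X) hδ] with v hv
    exact h x hx f hf hfx v (by simpa using hv)
  have hs : ∀ x : X, ‖x‖ = 1 → ∃ f : StrongDual ℝ X, ‖f‖ ≤ 1 ∧ f x = 1 := fun x hx => by
    simpa [hx] using exists_dual_vector'' ℝ x
  refine ⟨fun x hx => ?_, fun ε hε => ?_⟩
  · obtain ⟨f, hf, hfx⟩ := hs x hx
    exact (hd x hx f hf hfx).differentiableAt
  · obtain ⟨δ, hδ, h⟩ := H.norm_add_sub_le hε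
    refine ⟨δ, hδ, fun x hx v hv => ?_⟩
    obtain ⟨f, hf, hfx⟩ := hs x hx
    rw [(hd x hx f hf hfx).fderiv]
    exact h x hx f hf hfx v hv

end Smooth

/-! ### Reflexivity and weak limits -/

section Reflexive

open NormedSpace

variable {X : Type*} [NormedAddCommGroup X] [NormedSpace ℝ X]

theorem exists_lt_apply_of_lt_norm {f : StrongDual ℝ X} {r : ℝ} (hr : r < ‖f‖) :
    ∃ x : X, ‖x‖ ≤ 1 ∧ r < f x := by
  obtain ⟨x, hx, hfx⟩ := f.exists_lt_apply_of_lt_opNorm hr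
  rcases abs_choice (f x) with h | h
  · exact ⟨x, hx.le, by rwa [Real.norm_eq_abs, h] at hfx⟩
  · exact ⟨-x, by simpa using hx.le, by rwa [Real.norm_eq_abs, h, ← map_neg] at hfx⟩

/-- Functionals almost attaining their norm at the same vector are close to each other (a form of
uniform convexity of the dual norm). -/
theorem HasLocalContractions.dual_close (H : HasLocalContractions X) {ε : ℝ} (hε : 0 < ε) :
    ∃ η : ℝ, 0 < η ∧ ∀ x : X, ‖x‖ ≤ 1 → ∀ f g : StrongDual ℝ X, ‖f‖ ≤ 1 → ‖g‖ ≤ 1 →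
      1 - η < f x → 1 - η < g x → ‖f - g‖ ≤ ε := by
  obtain ⟨δ, hδ, hn⟩ := H.norm_add_sub_le (ε := ε / 4) (by positivity)
  refine ⟨min 1 (ε / 4 * (δ / 2)), by positivity, fun x hx1 f g hf hg hfx hgx => ?_⟩
  have hm1 := min_le_left 1 (ε / 4 * (δ / 2))
  have hm2 := min_le_right 1 (ε / 4 * (δ / 2))
  have hx0 : 0 < ‖x‖ :=
    lt_of_lt_of_le (by linarith) (apply_le_norm_of_norm_le_one hf x)
  set y := ‖x‖⁻¹ • x with hy
  have hy1 : ‖y‖ = 1 := by rw [hy, norm_smul, norm_inv, norm_norm, inv_mul_cancel₀ hx0.ne']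
  have hle : ∀ {k : StrongDual ℝ X}, 1 - min 1 (ε / 4 * (δ / 2)) < k x →
      1 - min 1 (ε / 4 * (δ / 2)) < k y := by
    intro k hk
    rw [hy, map_smul, smul_eq_mul]
    have : 1 ≤ ‖x‖⁻¹ := (one_le_inv₀ hx0).mpr hx1
    nlinarith
  have hfy := hle hfx
  have hgy := hle hgx
  obtain ⟨j, hj, hjy⟩ := exists_dual_vector'' ℝ y
  simp only [RCLike.ofReal_real_eq_id, id_eq, hy1] at hjy
  have hv : ∀ v : X, ‖v‖ = 1 → (f - g) v ≤ ε := by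
    intro v hv
    have ht : ‖(δ / 2) • v‖ = δ / 2 := by
      rw [norm_smul, hv, mul_one, Real.norm_of_nonneg (by positivity)]
    have a1 := (le_abs_self _).trans (hn y hy1 j hj hjy ((δ / 2) • v) (by rw [ht]; linarith))
    have a2 := (le_abs_self _).trans
      (hn y hy1 j hj hjy (-((δ / 2) • v)) (by rw [norm_neg, ht]; linarith))
    have b1 := apply_le_norm_of_norm_le_one hf (y + (δ / 2) • v)
    have b2 := apply_le_norm_of_norm_le_one hg (y + -((δ / 2) • v))
    simp only [norm_neg, ht, hy1, map_neg, map_add, map_smul, smul_eq_mul] at a1 a2 b1 b2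
    have : δ / 2 * (f v - g v) ≤ δ / 2 * ε := by linarith
    rw [sub_apply]
    exact le_of_mul_le_mul_left this (by positivity)
  refine ContinuousLinearMap.opNorm_le_of_unit_norm hε.le fun v hv1 => ?_
  rw [Real.norm_eq_abs, abs_le]
  have := hv (-v) (by rwa [norm_neg])
  rw [map_neg] at this
  exact ⟨by linarith, hv v hv1⟩

/-- The restriction of a functional `Φ` to the kernel of a functional `L` has norm at least the
distance from `Φ` to the line through `L`: a norm-preserving extension of the restriction differs
from `Φ` by a multiple of `L`. -/
theorem exists_lt_apply_of_apply_eq_zero {Φ L : StrongDual ℝ X} {r s : ℝ}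
    (hr : ∀ c : ℝ, r ≤ ‖Φ - c • L‖) {f : X} (hf : L f ≠ 0) (hs : s < r) :
    ∃ g : X, ‖g‖ ≤ 1 ∧ L g = 0 ∧ s < Φ g := by
  obtain ⟨Ψ, hΨ, hn⟩ := exists_extension_norm_eq (LinearMap.ker L.toLinearMap)
    (Φ.comp (LinearMap.ker L.toLinearMap).subtypeL)
  have : Ψ = Φ - ((Φ - Ψ) f / L f) • L := by
    ext h
    have hk := hΨ ⟨h - (L h / L f) • f, by simp [hf]⟩
    simp only [map_sub, map_smul, smul_eq_mul, ContinuousLinearMap.comp_apply,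
      Submodule.subtypeL_apply] at hk
    simp only [sub_apply, smul_apply, smul_eq_mul]
    field_simp at hk ⊢
    linarith
  obtain ⟨g, hg, hΦg⟩ := exists_lt_apply_of_lt_norm (hs.trans_le ((hr _).trans (this ▸ hn.le)))
  exact ⟨g, hg, g.2, hΦg⟩

theorem LinearIsometry.exists_far_from_range [CompleteSpace X] {E : Type*} [NormedAddCommGroup E]
    [NormedSpace ℝ E] (i : X →ₗᵢ[ℝ] E) (hi : ¬ Function.Surjective i) {η : ℝ} (hη : 0 < η) :
    ∃ Φ : E, ‖Φ‖ = 1 ∧ ∀ y : X, 1 - η ≤ ‖Φ - i y‖ := by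
  have hcl : IsClosed ((LinearMap.range i.toLinearMap : Submodule ℝ E) : Set E) := by
    have := i.isometry.isClosedEmbedding.isClosed_range
    rwa [← i.coe_toLinearMap, ← LinearMap.coe_range] at this
  simp only [Function.Surjective, not_forall] at hi
  obtain ⟨Φ₀, hΦ₀⟩ := hi
  obtain ⟨Φ₁, hΦ₁, hd₁⟩ := riesz_lemma hcl ⟨Φ₀, fun ⟨x, hx⟩ => hΦ₀ ⟨x, hx⟩⟩
    (show 1 - η < 1 by linarith)
  have hpos : 0 < ‖Φ₁‖ := norm_pos_iff.mpr fun h => hΦ₁ (h ▸ Submodule.zero_mem _)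
  refine ⟨‖Φ₁‖⁻¹ • Φ₁, by rw [norm_smul, norm_inv, norm_norm, inv_mul_cancel₀ hpos.ne'],
    fun y => ?_⟩
  have h1 := hd₁ (i (‖Φ₁‖ • y)) ⟨_, rfl⟩
  have h2 : Φ₁ - i (‖Φ₁‖ • y) = ‖Φ₁‖ • (‖Φ₁‖⁻¹ • Φ₁ - i y) := by
    rw [smul_sub, smul_smul, mul_inv_cancel₀ hpos.ne', one_smul, map_smul]
  rw [h2, norm_smul, norm_norm, mul_comm] at h1
  exact le_of_mul_le_mul_left h1 hpos

/-- Reflexivity. If some `Φ` of norm one in the bidual is almost at distance one from `X`, take `f`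
with `Φ f ≈ 1`, then `x` with `f x ≈ 1`, then `g` with `Φ g ≈ 1` and `g x = 0`; the first and the
last make `f` and `g` close, contradicting `(f - g) x ≈ 1`. -/
theorem HasLocalContractions.surjective_inclusionInDoubleDual [CompleteSpace X]
    (H : HasLocalContractions X) : Function.Surjective (inclusionInDoubleDual ℝ X) := by
  by_contra hns
  obtain ⟨η', hη', hc⟩ := H.dual_close (ε := 1 / 2) (by norm_num)
  set η := min (η' / 4) (1 / 8) with hη_def
  have hη : 0 < η := by positivity
  have hη1 : η ≤ η' / 4 := min_le_left _ _
  have hη2 : η ≤ 1 / 8 := min_le_right _ _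
  obtain ⟨Φ, hΦn, hd⟩ := LinearIsometry.exists_far_from_range (X := X)
    (E := StrongDual ℝ (StrongDual ℝ X)) (inclusionInDoubleDualLi ℝ) hns hη
  obtain ⟨f, hf, hΦf⟩ := exists_lt_apply_of_lt_norm (f := Φ) (r := 1 - η) (by linarith)
  have hfn : 1 - η < ‖f‖ := hΦf.trans_le (apply_le_norm_of_norm_le_one hΦn.le f)
  obtain ⟨x, hx, hfx⟩ := exists_lt_apply_of_lt_norm hfn
  obtain ⟨g, hg1, hgx, hΦg⟩ := exists_lt_apply_of_apply_eq_zero (Φ := Φ)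
    (L := inclusionInDoubleDual ℝ X x) (f := f) (s := 1 - 2 * η)
    (fun c => by rw [← map_smul]; exact hd (c • x)) (by rw [dual_def]; linarith) (by linarith)
  rw [dual_def] at hgx
  have hsum : 2 - 3 * η < ‖f + g‖ := by
    have := apply_le_norm_of_norm_le_one hΦn.le (f + g)
    rw [map_add] at this
    linarith
  obtain ⟨z, hz, hfgz⟩ := exists_lt_apply_of_lt_norm hsum
  rw [add_apply] at hfgz
  have c1 := apply_le_norm_of_norm_le_one hf z
  have c2 := apply_le_norm_of_norm_le_one hg1 z
  have := hc z hz f g hf hg1 (by linarith) (by linarith)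
  have h3 := (le_abs_self _).trans ((f - g).le_of_opNorm_le this x)
  rw [sub_apply, hgx] at h3
  linarith

theorem WeakDual.locallyConvexSpace_real (E : Type*) [NormedAddCommGroup E] [NormedSpace ℝ E] :
    LocallyConvexSpace ℝ (WeakDual ℝ E) :=
  WeakBilin.locallyConvexSpace (𝕜 := ℝ) (E := StrongDual ℝ E) (F := E) (B := topDualPairing ℝ E)

theorem WeakDual.mem_preimage_closedBall_zero {E : Type*} [NormedAddCommGroup E] [NormedSpace ℝ E]
    {Φ : WeakDual ℝ E} {C : ℝ} :
    Φ ∈ WeakDual.toStrongDual ⁻¹' Metric.closedBall (0 : StrongDual ℝ E) C ↔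
      ‖WeakDual.toStrongDual Φ‖ ≤ C := by
  rw [Set.mem_preimage, mem_closedBall_zero_iff]

/-- In a reflexive space a bounded sequence converges weakly along an ultrafilter. -/
theorem exists_weak_limit_hyperfilter (hs : Function.Surjective (inclusionInDoubleDual ℝ X))
    {u : ℕ → X} {C : ℝ} (hu : ∀ n, ‖u n‖ ≤ C) :
    ∃ x : X, ∀ f : StrongDual ℝ X,
      Filter.Tendsto (fun n => f (u n)) (Filter.hyperfilter ℕ) (𝓝 (f x)) := by
  have hK := WeakDual.isCompact_closedBall (𝕜 := ℝ) (E := StrongDual ℝ X) 0 C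
  let J : ℕ → WeakDual ℝ (StrongDual ℝ X) :=
    fun n => StrongDual.toWeakDual (inclusionInDoubleDual ℝ X (u n))
  obtain ⟨Φ, -, hΦ⟩ := hK.ultrafilter_le_nhds ((Filter.hyperfilter ℕ).map J) (by
    rw [Ultrafilter.coe_map, Filter.le_principal_iff]
    refine Filter.mem_map.mpr (Filter.univ_mem' fun n => ?_)
    exact WeakDual.mem_preimage_closedBall_zero.mpr
      ((double_dual_bound ℝ X (u n)).trans (hu n)))
  obtain ⟨x, hx⟩ := hs (WeakDual.toStrongDual Φ)
  refine ⟨x, fun f => ?_⟩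
  have h1 : Filter.Tendsto J (Filter.hyperfilter ℕ) (𝓝 Φ) := hΦ
  have h2 := ((WeakDual.eval_continuous f).tendsto Φ).comp h1
  have h3 : Φ f = f x := by
    rw [← dual_def ℝ X x f, hx]; rfl
  rw [← h3]
  exact h2

/-- The closed unit ball of a reflexive space has an extreme point: by Banach-Alaoglu and
Krein-Milman the ball of the bidual has one. -/
theorem exists_extreme_point_closedBall (hs : Function.Surjective (inclusionInDoubleDual ℝ X)) :
    ∃ x : X, ‖x‖ ≤ 1 ∧ ∀ u : X, ‖x + u‖ ≤ 1 → ‖x - u‖ ≤ 1 → u = 0 := by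
  have hK := WeakDual.isCompact_closedBall (𝕜 := ℝ) (E := StrongDual ℝ X) 0 1
  have := WeakDual.locallyConvexSpace_real (StrongDual ℝ X)
  obtain ⟨Φ, hΦ⟩ := hK.extremePoints_nonempty ⟨0, by simp⟩
  obtain ⟨x, hx⟩ := hs (WeakDual.toStrongDual Φ)
  have hmem : ∀ y : X, ‖y‖ ≤ 1 → StrongDual.toWeakDual (inclusionInDoubleDual ℝ X y) ∈
      (WeakDual.toStrongDual ⁻¹' Metric.closedBall (0 : StrongDual ℝ (StrongDual ℝ X)) 1) := by
    intro y hy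
    exact WeakDual.mem_preimage_closedBall_zero.mpr ((double_dual_bound ℝ X y).trans hy)
  have hxn : ‖inclusionInDoubleDual ℝ X x‖ = ‖x‖ := (inclusionInDoubleDualLi (E := X) ℝ).norm_map x
  have hΦx : Φ = StrongDual.toWeakDual (inclusionInDoubleDual ℝ X x) := by rw [hx]; rfl
  refine ⟨x, ?_, fun u h1 h2 => ?_⟩
  · rw [← hxn, hx]
    exact WeakDual.mem_preimage_closedBall_zero.mp hΦ.1
  · have := (mem_extremePoints.mp hΦ).2 _ (hmem _ h1) _ (hmem _ h2) (by
      refine ⟨1 / 2, 1 / 2, by norm_num, by norm_num, by norm_num, ?_⟩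
      rw [← map_smul, ← map_smul, ← map_smul, ← map_smul, ← map_add, ← map_add, hΦx]
      congr 2
      module)
    have h3 : inclusionInDoubleDual ℝ X (x + u) = inclusionInDoubleDual ℝ X x := by
      have := this.1.trans hΦx
      exact StrongDual.toWeakDual.injective this
    have h4 := (inclusionInDoubleDualLi (E := X) ℝ).injective h3
    simpa using h4

end Reflexive

/-! ### Contractions between arbitrary unit vectors -/

section Chain

variable {X : Type*} [NormedAddCommGroup X] [NormedSpace ℝ X]

/-- If `‖x + y‖ ≥ 1`, the segment from `x` to `y` stays away from the origin. -/
theorem quarter_le_norm_segment {x y : X} (hx : ‖x‖ = 1) (hy : ‖y‖ = 1) (hxy : 1 ≤ ‖x + y‖)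
    {t : ℝ} (h0 : 0 ≤ t) (h1 : t ≤ 1) : 1 / 4 ≤ ‖(1 - t) • x + t • y‖ := by
  have key : ∀ {x y : X}, ‖x‖ = 1 → ‖y‖ = 1 → 1 ≤ ‖x + y‖ → ∀ {t : ℝ}, 0 ≤ t → t ≤ 1 / 2 →
      1 / 4 ≤ ‖(1 - t) • x + t • y‖ := by
    intro x y hx hy hxy t h0 h1
    have a1 : ‖x‖ ≤ ‖(1 - t) • x + t • y‖ + t * ‖x - y‖ := by
      have : x = ((1 - t) • x + t • y) + t • (x - y) := by module
      calc ‖x‖ = ‖((1 - t) • x + t • y) + t • (x - y)‖ := by rw [← this]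
        _ ≤ ‖(1 - t) • x + t • y‖ + ‖t • (x - y)‖ := norm_add_le _ _
        _ = _ := by rw [norm_smul, Real.norm_of_nonneg h0]
    have a2 : ‖x + y‖ ≤ 2 * ‖(1 - t) • x + t • y‖ + (1 - 2 * t) * ‖x - y‖ := by
      have : x + y = (2 : ℝ) • ((1 - t) • x + t • y) - (1 - 2 * t) • (x - y) := by module
      calc ‖x + y‖ = ‖(2 : ℝ) • ((1 - t) • x + t • y) - (1 - 2 * t) • (x - y)‖ := by rw [← this]
        _ ≤ ‖(2 : ℝ) • ((1 - t) • x + t • y)‖ + ‖(1 - 2 * t) • (x - y)‖ := norm_sub_le _ _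
        _ = _ := by
          rw [norm_smul, norm_smul, Real.norm_of_nonneg (by linarith : 0 ≤ 1 - 2 * t),
            Real.norm_of_nonneg zero_le_two]
    have a3 : ‖x - y‖ ≤ 2 := (norm_sub_le x y).trans (by rw [hx, hy]; norm_num)
    nlinarith
  rcases le_total t (1 / 2) with h | h
  · exact key hx hy hxy h0 h
  · have := key hy hx (by rwa [add_comm]) (t := 1 - t) (by linarith) (by linarith)
    rwa [sub_sub_cancel, add_comm] at this

/-- Any unit vector is mapped to any other one by a contraction that is bounded below by a constant
independent of the two vectors. The contraction is a product of contractions given by the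
hypothesis along the normalized segment from `x` to `y` or to `-y`, followed by `-1` in the second
case; the choice of sign keeps the segment away from the origin, which bounds the number of
factors. -/
theorem HasLocalContractions.exists_contraction (H : HasLocalContractions X) :
    ∃ c : ℝ, 0 < c ∧ ∀ x y : X, ‖x‖ = 1 → ‖y‖ = 1 →
      ∃ T : X →L[ℝ] X, (∀ v, ‖T v‖ ≤ ‖v‖) ∧ T x = y ∧ ∀ v, c * ‖v‖ ≤ ‖T v‖ := by
  obtain ⟨β, hβ, h⟩ := H (1 / 2) (by norm_num)
  -- `16` is the Lipschitz constant of the normalized segment.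
  obtain ⟨N, hN⟩ := exists_nat_gt (16 / β)
  have hNpos : (0 : ℝ) < N := lt_trans (by positivity) hN
  have main : ∀ x y : X, ‖x‖ = 1 → ‖y‖ = 1 → 1 ≤ ‖x + y‖ →
      ∃ T : X →L[ℝ] X, (∀ v, ‖T v‖ ≤ ‖v‖) ∧ T x = y ∧ ∀ v, (1 / 2) ^ N * ‖v‖ ≤ ‖T v‖ := by
    intro x y hx hy hxy
    let p : ℝ → X := fun t => (1 - t) • x + t • y
    have hp : ∀ {t : ℝ}, 0 ≤ t → t ≤ 1 → 1 / 4 ≤ ‖p t‖ := quarter_le_norm_segment hx hy hxy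
    let q : ℝ → X := fun t => ‖p t‖⁻¹ • p t
    have hq1 : ∀ {t : ℝ}, 0 ≤ t → t ≤ 1 → ‖q t‖ = 1 := fun h0 h1 => by
      have : ‖p _‖ ≠ 0 := (lt_of_lt_of_le (by norm_num) (hp h0 h1)).ne'
      rw [norm_smul, norm_inv, norm_norm, inv_mul_cancel₀ this]
    have hqq : ∀ {s t : ℝ}, 0 ≤ s → s ≤ 1 → 0 ≤ t → t ≤ 1 → ‖q s - q t‖ ≤ 16 * |t - s| := by
      intro s t hs0 hs1 ht0 ht1
      have e1 : ‖p t - p s‖ ≤ 2 * |t - s| := by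
        have : p t - p s = (t - s) • (y - x) := by simp only [p]; module
        rw [this, norm_smul, Real.norm_eq_abs, mul_comm]
        gcongr
        exact (norm_sub_le y x).trans (by rw [hx, hy]; norm_num)
      have hps := hp hs0 hs1
      have hpt := hp ht0 ht1
      have hs0' : 0 < ‖p s‖ := by linarith
      -- Rescaling both points by `‖p s‖⁻¹` reduces to normalizing a point near a unit vector.
      have e2 : ‖q s - q t‖ ≤ 2 * ‖‖p s‖⁻¹ • p t - q s‖ := by
        have hz : ‖p s‖⁻¹ • p t ≠ 0 := by
          have : p t ≠ 0 := norm_pos_iff.mp (by linarith)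
          exact smul_ne_zero (inv_ne_zero hs0'.ne') this
        have := norm_normalize_sub_le hz (hq1 hs0 hs1)
        convert this using 3
        simp only [q]
        rw [norm_smul, norm_inv, norm_norm, smul_smul]
        congr 1
        field_simp
      have e3 : ‖‖p s‖⁻¹ • p t - q s‖ ≤ 4 * ‖p t - p s‖ := by
        simp only [q]
        rw [← smul_sub, norm_smul, norm_inv, norm_norm]
        gcongr
        rw [inv_le_comm₀ hs0' (by norm_num)]
        linarith
      linarith
    have ind : ∀ n : ℕ, n ≤ N → ∃ T : X →L[ℝ] X, (∀ v, ‖T v‖ ≤ ‖v‖) ∧ T (q 0) = q (n / N) ∧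
        ∀ v, (1 / 2) ^ n * ‖v‖ ≤ ‖T v‖ := by
      intro n
      induction n with
      | zero => exact fun _ => ⟨ContinuousLinearMap.id ℝ X, by simp, by simp, by simp⟩
      | succ n ih =>
        intro hn
        obtain ⟨T, hT, hTx, hTc⟩ := ih (by omega)
        have i0 : (0 : ℝ) ≤ n / N := by positivity
        have i1 : (n : ℝ) / N ≤ 1 := by
          rw [div_le_one hNpos]; exact_mod_cast (by omega : n ≤ N)
        have j0 : (0 : ℝ) ≤ (n + 1 : ℕ) / N := by positivity
        have j1 : ((n + 1 : ℕ) : ℝ) / N ≤ 1 := by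
          rw [div_le_one hNpos]; exact_mod_cast hn
        obtain ⟨S, hS, hSx, hSI⟩ := h _ _ (hq1 i0 i1) (hq1 j0 j1) (by
          refine (hqq i0 i1 j0 j1).trans_lt ?_
          have : ((n + 1 : ℕ) : ℝ) / N - n / N = 1 / N := by push_cast; ring
          rw [this, abs_of_pos (by positivity), mul_one_div, div_lt_comm₀ hNpos hβ]
          exact hN)
        refine ⟨S.comp T, fun v => (hS _).trans (hT v), by simp [hTx, hSx], fun v => ?_⟩
        have l1 : ‖T v‖ ≤ ‖S (T v)‖ + ‖S (T v) - T v‖ := by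
          have := norm_sub_le (S (T v)) (S (T v) - T v)
          rwa [sub_sub_cancel] at this
        have l2 := hSI (T v)
        have l3 := hTc v
        rw [ContinuousLinearMap.comp_apply, pow_succ]
        linarith
    obtain ⟨T, hT, hTx, hTc⟩ := ind N le_rfl
    have hq0 : q 0 = x := by simp [q, p, hx]
    have hqN : q (N / N) = y := by rw [div_self hNpos.ne']; simp [q, p, hy]
    rw [hq0, hqN] at hTx
    exact ⟨T, hT, hTx, hTc⟩
  refine ⟨(1 / 2) ^ N, by positivity, fun x y hx hy => ?_⟩
  by_cases hxy : 1 ≤ ‖x + y‖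
  · exact main x y hx hy hxy
  · have hxy' : 1 ≤ ‖x + -y‖ := by
      have hx2 : (2 : ℝ) • x = (x + y) + (x + -y) := by module
      have h2 : ‖(2 : ℝ) • x‖ = 2 := by rw [norm_smul, hx]; norm_num
      have := norm_add_le (x + y) (x + -y)
      rw [← hx2, h2] at this
      linarith
    obtain ⟨T, hT, hTx, hTc⟩ := main x (-y) hx (by rwa [norm_neg]) hxy'
    exact ⟨-T, by simpa using hT, by simp [hTx], by simpa using hTc⟩

end Chain

/-! ### Failure of uniform convexity -/

section Convex

open NormedSpace Filter

variable {X : Type*} [NormedAddCommGroup X] [NormedSpace ℝ X]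

/-- If uniform convexity fails, then every unit vector is nearly the midpoint of a segment in the
ball whose length is bounded below: transport the centres of the bad segments by contractions. -/
theorem HasLocalContractions.exists_long_segment (H : HasLocalContractions X) {ε : ℝ} (hε : 0 < ε)
    (huc : ∀ δ : ℝ, 0 < δ → ∃ x y : X, ‖x‖ = 1 ∧ ‖y‖ = 1 ∧ ε ≤ ‖x - y‖ ∧ 2 - δ < ‖x + y‖) :
    ∃ c : ℝ, 0 < c ∧ ∀ z : X, ‖z‖ = 1 → ∀ δ : ℝ, 0 < δ →
      ∃ u : X, c ≤ ‖u‖ ∧ ‖z + u‖ ≤ 1 + δ ∧ ‖z - u‖ ≤ 1 + δ := by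
  obtain ⟨c, hc, hT⟩ := H.exists_contraction
  refine ⟨c * (ε / 2), by positivity, fun z hz δ hδ => ?_⟩
  obtain ⟨x, y, hx, hy, hxy, hs⟩ := huc (min δ 1) (by positivity)
  have hm1 := min_le_left δ 1
  have hm2 := min_le_right δ 1
  have hpos : 0 < ‖x + y‖ := by linarith
  have hle : ‖x + y‖ ≤ 2 := (norm_add_le x y).trans (by rw [hx, hy]; norm_num)
  set w := ‖x + y‖⁻¹ • (x + y) with hw
  have hw1 : ‖w‖ = 1 := by rw [hw, norm_smul, norm_inv, norm_norm, inv_mul_cancel₀ hpos.ne']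
  have hwm : ‖w - (1 / 2 : ℝ) • (x + y)‖ ≤ δ := by
    have : w - (1 / 2 : ℝ) • (x + y) = (1 - ‖x + y‖ / 2) • w := by
      rw [sub_smul, one_smul, hw, smul_smul, div_mul_eq_mul_div, mul_inv_cancel₀ hpos.ne']
    rw [this, norm_smul, hw1, mul_one, Real.norm_of_nonneg (by linarith)]
    linarith
  obtain ⟨T, hT1, hTw, hTc⟩ := hT w z hw1 hz
  refine ⟨T ((1 / 2 : ℝ) • (x - y)), ?_, ?_, ?_⟩
  · refine le_trans ?_ (hTc _)
    rw [norm_smul, Real.norm_of_nonneg (by norm_num)]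
    gcongr
    linarith
  · rw [← hTw, ← map_add]
    refine (hT1 _).trans ?_
    have : w + (1 / 2 : ℝ) • (x - y) = x + (w - (1 / 2 : ℝ) • (x + y)) := by module
    rw [this]
    exact (norm_add_le _ _).trans (by rw [hx]; linarith)
  · rw [← hTw, ← map_sub]
    refine (hT1 _).trans ?_
    have : w - (1 / 2 : ℝ) • (x - y) = y + (w - (1 / 2 : ℝ) • (x + y)) := by module
    rw [this]
    exact (norm_add_le _ _).trans (by rw [hy]; linarith)

/-- At an extreme point of the ball of a reflexive space, half-lengths of almost-segments centred
there converge weakly to zero. -/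
theorem exists_weakly_null (hs : Function.Surjective (inclusionInDoubleDual ℝ X)) [Nontrivial X]
    {c : ℝ} (hseg : ∀ z : X, ‖z‖ = 1 → ∀ δ : ℝ, 0 < δ →
      ∃ u : X, c ≤ ‖u‖ ∧ ‖z + u‖ ≤ 1 + δ ∧ ‖z - u‖ ≤ 1 + δ) :
    ∃ (x : X) (u : ℕ → X), ‖x‖ = 1 ∧ (∀ n, c ≤ ‖u n‖) ∧
      (∀ n, ‖x + u n‖ ≤ 1 + 1 / ((n : ℝ) + 1)) ∧ (∀ n, ‖x - u n‖ ≤ 1 + 1 / ((n : ℝ) + 1)) ∧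
      ∀ f : StrongDual ℝ X, Tendsto (fun n => f (u n)) (hyperfilter ℕ) (𝓝 0) := by
  obtain ⟨x, hx1, hext⟩ := exists_extreme_point_closedBall hs
  have hx : ‖x‖ = 1 := by
    by_contra hne
    have hlt : 0 < 1 - ‖x‖ := sub_pos.mpr (lt_of_le_of_ne hx1 hne)
    obtain ⟨v, hv⟩ := exists_norm_eq X hlt.le
    have := hext v ((norm_add_le x v).trans (by linarith)) ((norm_sub_le x v).trans (by linarith))
    rw [this, norm_zero] at hv
    exact hlt.ne hv
  choose u hu1 hu2 hu3 using fun n : ℕ => hseg x hx (1 / ((n : ℝ) + 1)) (by positivity)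
  have hb : ∀ n, ‖u n‖ ≤ 3 := by
    intro n
    have h1 : 1 / ((n : ℝ) + 1) ≤ 1 := by
      rw [div_le_one (by positivity)]; linarith [n.cast_nonneg (α := ℝ)]
    have := norm_sub_le (x + u n) x
    rw [add_sub_cancel_left] at this
    linarith [hu2 n]
  obtain ⟨w, hw⟩ := exists_weak_limit_hyperfilter hs hb
  have hlim : Tendsto (fun n : ℕ => 1 + 1 / ((n : ℝ) + 1)) (hyperfilter ℕ) (𝓝 1) := by
    have := (tendsto_one_div_add_atTop_nhds_zero_nat (𝕜 := ℝ)).const_add 1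
    rw [add_zero] at this
    exact this.mono_left Nat.hyperfilter_le_atTop
  have hlsc : ∀ y : X, ∀ v : ℕ → X, (∀ n, ‖v n‖ ≤ 1 + 1 / ((n : ℝ) + 1)) →
      (∀ f : StrongDual ℝ X, Tendsto (fun n => f (v n)) (hyperfilter ℕ) (𝓝 (f y))) → ‖y‖ ≤ 1 := by
    intro y v hv hy
    obtain ⟨f, hf, hfy⟩ := exists_dual_vector'' ℝ y
    simp only [RCLike.ofReal_real_eq_id, id_eq] at hfy
    rw [← hfy]
    exact le_of_tendsto_of_tendsto' (hy f) hlim fun n =>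
      (apply_le_norm_of_norm_le_one hf _).trans (hv n)
  have hw0 : w = 0 := by
    refine hext w (hlsc _ _ hu2 fun f => ?_) (hlsc _ _ hu3 fun f => ?_)
    · simpa only [map_add] using (hw f).const_add (f x)
    · simpa only [map_sub] using (hw f).const_sub (f x)
  exact ⟨x, u, hx, hu1, hu2, hu3, fun f => by simpa [hw0] using hw f⟩

/-- A bounded weakly null sequence that is bounded away from zero eventually stays away from any
given finite-dimensional subspace. -/
theorem eventually_le_norm_sub_of_weakly_null {l : Ultrafilter ℕ} {u : ℕ → X} {c C : ℝ}
    (hc : 0 < c) (hu : ∀ n, c ≤ ‖u n‖) (hC : ∀ n, ‖u n‖ ≤ C)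
    (hw : ∀ f : StrongDual ℝ X, Tendsto (fun n => f (u n)) l (𝓝 0))
    (F : Submodule ℝ X) [FiniteDimensional ℝ F] :
    ∀ᶠ n in l, ∀ w ∈ F, c / 3 ≤ ‖u n - w‖ := by
  by_contra hcon
  rw [← Ultrafilter.eventually_not] at hcon
  obtain ⟨w, hwn⟩ : ∃ w : ℕ → F, ∀ᶠ n in l, ‖u n - w n‖ < c / 3 := by
    have : ∀ n, ∃ w : F, (¬ ∀ w ∈ F, c / 3 ≤ ‖u n - w‖) → ‖u n - w‖ < c / 3 := by
      intro n
      by_cases h : ∀ w ∈ F, c / 3 ≤ ‖u n - w‖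
      · exact ⟨0, fun h' => (h' h).elim⟩
      · push Not at h
        obtain ⟨w, hwF, hw⟩ := h
        exact ⟨⟨w, hwF⟩, fun _ => hw⟩
    choose w hw using this
    exact ⟨w, hcon.mono hw⟩
  have := FiniteDimensional.proper_real F
  obtain ⟨y, -, hy⟩ := (isCompact_closedBall (0 : F) (C + c / 3)).ultrafilter_le_nhds (l.map w) (by
    rw [Ultrafilter.coe_map, le_principal_iff]
    refine mem_map.mpr (hwn.mono fun n hn => ?_)
    rw [mem_closedBall_zero_iff]
    have := norm_sub_le (u n) (u n - w n)
    rw [sub_sub_cancel] at this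
    exact this.trans (add_le_add (hC n) hn.le))
  have hlim : Tendsto (fun n => (w n : X)) l (𝓝 (y : X)) :=
    (continuous_subtype_val.tendsto y).comp hy
  have hy1 : 2 * c / 3 ≤ ‖(y : X)‖ := by
    refine ge_of_tendsto hlim.norm (hwn.mono fun n hn => ?_)
    have := norm_add_le (u n - w n) (w n)
    rw [sub_add_cancel] at this
    linarith [hu n]
  obtain ⟨f, hf, hfy⟩ := exists_dual_vector'' ℝ (y : X)
  simp only [RCLike.ofReal_real_eq_id, id_eq] at hfy
  have hy2 : f y ≤ c / 3 := by
    have h1 : Tendsto (fun n => f (w n) - f (u n)) l (𝓝 (f y - 0)) :=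
      ((f.continuous.tendsto _).comp hlim).sub (hw f)
    rw [sub_zero] at h1
    refine le_of_tendsto h1 (hwn.mono fun n hn => ?_)
    rw [← map_sub]
    refine (apply_le_norm_of_norm_le_one hf _).trans ?_
    rw [norm_sub_rev]
    exact hn.le
  linarith

/-- Hahn-Banach: a vector at distance at least `d` from a subspace. -/
theorem exists_dual_vanishing {F : Submodule ℝ X} {u : X} {d : ℝ} (hd : ∀ w ∈ F, d ≤ ‖u - w‖) :
    ∃ g : StrongDual ℝ X, ‖g‖ ≤ 1 ∧ (∀ y ∈ F, g y = 0) ∧ d ≤ g u := by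
  obtain ⟨g, hg, hgu⟩ := exists_dual_vector'' ℝ (F.mkQ u)
  simp only [RCLike.ofReal_real_eq_id, id_eq] at hgu
  have hmk : ∀ v : X, ‖F.mkQ v‖ ≤ ‖v‖ := fun v => Submodule.Quotient.norm_mk_le F v
  have hb : ∀ v : X, ‖g (F.mkQ v)‖ ≤ 1 * ‖v‖ := fun v =>
    (g.le_opNorm _).trans (mul_le_mul hg (hmk v) (norm_nonneg _) zero_le_one)
  refine ⟨LinearMap.mkContinuous (g.toLinearMap ∘ₗ F.mkQ) 1 hb,
    LinearMap.mkContinuous_norm_le _ zero_le_one _, fun y hy => ?_, ?_⟩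
  · have : F.mkQ y = 0 := (Submodule.Quotient.mk_eq_zero F).mpr hy
    simp only [LinearMap.mkContinuous_apply, LinearMap.comp_apply, this, map_zero]
  · change d ≤ g (F.mkQ u)
    rw [hgu]
    refine le_of_forall_pos_lt_add fun e he => ?_
    obtain ⟨m, hm, hmn⟩ := Submodule.Quotient.norm_mk_lt (S := F) (F.mkQ u) he
    have hmem : u - m ∈ F := by
      rw [← Submodule.Quotient.eq]; exact hm.symm
    have := hd _ hmem
    rw [sub_sub_cancel] at this
    exact this.trans_lt hmn

end Convex

/-! ### Uniform convexity -/

section UniformConvex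

open NormedSpace Filter

variable {X : Type*} [NormedAddCommGroup X] [NormedSpace ℝ X]

/-- The inductive step: from any `z` one can move by a vector `u` that hardly changes the norm and
the values of finitely many given functionals, but that is uniformly detected by a functional
vanishing on a given finite-dimensional subspace. The vectors `u` are images, under a contraction,
of a weakly null sequence of half-segments at an extreme point of the ball. -/
theorem HasLocalContractions.exists_step (H : HasLocalContractions X)
    (hs : Function.Surjective (inclusionInDoubleDual ℝ X)) [Nontrivial X] {ε : ℝ} (hε : 0 < ε)
    (huc : ∀ δ : ℝ, 0 < δ → ∃ x y : X, ‖x‖ = 1 ∧ ‖y‖ = 1 ∧ ε ≤ ‖x - y‖ ∧ 2 - δ < ‖x + y‖) :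
    ∃ c : ℝ, 0 < c ∧ ∀ z : X, 1 ≤ ‖z‖ → ∀ δ : ℝ, 0 < δ → ∀ G : Finset (StrongDual ℝ X),
      ∀ F : Submodule ℝ X, FiniteDimensional ℝ F →
        ∃ u : X, 1 ≤ ‖z + u‖ ∧ ‖z + u‖ ≤ ‖z‖ + δ ∧ (∀ f ∈ G, |f u| ≤ δ) ∧
          ∃ g : StrongDual ℝ X, ‖g‖ ≤ 1 ∧ (∀ y ∈ F, g y = 0) ∧ c ≤ g u := by
  obtain ⟨c₀, hc₀, hseg⟩ := H.exists_long_segment hε huc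
  obtain ⟨x, u, hx, hu, hu1, hu2, huw⟩ := exists_weakly_null hs hseg
  obtain ⟨c₁, hc₁, hT⟩ := H.exists_contraction
  have hcc : 0 < c₁ * c₀ := by positivity
  refine ⟨c₁ * c₀ / 3, by positivity, fun z hz δ hδ G F _ => ?_⟩
  have hzpos : 0 < ‖z‖ := by linarith
  have hz1 : ‖‖z‖⁻¹ • z‖ = 1 := by rw [norm_smul, norm_inv, norm_norm, inv_mul_cancel₀ hzpos.ne']
  obtain ⟨T, hT1, hTx, hTc⟩ := hT x _ hx hz1
  have hzT : ‖z‖ • T x = z := by rw [hTx, smul_smul, mul_inv_cancel₀ hzpos.ne', one_smul]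
  let v : ℕ → X := fun n => ‖z‖ • T (u n)
  have hv : ∀ n, c₁ * c₀ ≤ ‖v n‖ := by
    intro n
    have : c₁ * c₀ ≤ ‖T (u n)‖ := le_trans (by gcongr; exact hu n) (hTc (u n))
    simp only [v, norm_smul, norm_norm]
    nlinarith [norm_nonneg (T (u n))]
  have hv1 : ∀ n, ‖z + v n‖ ≤ ‖z‖ * (1 + 1 / ((n : ℝ) + 1)) := by
    intro n
    have : z + v n = ‖z‖ • T (x + u n) := by rw [map_add, smul_add, hzT]
    rw [this, norm_smul, norm_norm]
    gcongr
    exact (hT1 _).trans (hu1 n)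
  have hv2 : ∀ n, ‖z - v n‖ ≤ ‖z‖ * (1 + 1 / ((n : ℝ) + 1)) := by
    intro n
    have : z - v n = ‖z‖ • T (x - u n) := by rw [map_sub, smul_sub, hzT]
    rw [this, norm_smul, norm_norm]
    gcongr
    exact (hT1 _).trans (hu2 n)
  have hvC : ∀ n, ‖v n‖ ≤ ‖z‖ * 2 + ‖z‖ := by
    intro n
    have h1 : 1 / ((n : ℝ) + 1) ≤ 1 := by
      rw [div_le_one (by positivity)]; linarith [n.cast_nonneg (α := ℝ)]
    have h2 := norm_sub_le (z + v n) z
    rw [add_sub_cancel_left] at h2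
    nlinarith [hv1 n]
  have hvw : ∀ f : StrongDual ℝ X, Tendsto (fun n => f (v n)) (hyperfilter ℕ) (𝓝 0) := by
    intro f
    have := (huw (f.comp T)).const_mul ‖z‖
    simpa [v] using this
  have e1 := eventually_le_norm_sub_of_weakly_null hcc hv hvC hvw F
  have e2 : ∀ᶠ n in (hyperfilter ℕ : Filter ℕ), ∀ f ∈ G, |f (v n)| ≤ δ := by
    rw [eventually_all_finset]
    intro f _
    have := (hvw f).abs
    rw [abs_zero] at this
    exact this.eventually_le_const hδ
  have e3 : ∀ᶠ n : ℕ in (hyperfilter ℕ : Filter ℕ), ‖z‖ * (1 + 1 / ((n : ℝ) + 1)) ≤ ‖z‖ + δ := by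
    have := ((tendsto_one_div_add_atTop_nhds_zero_nat (𝕜 := ℝ)).const_add 1).const_mul ‖z‖
    rw [add_zero, mul_one] at this
    exact (this.mono_left Nat.hyperfilter_le_atTop).eventually_le_const (by linarith)
  obtain ⟨n, hn1, hn2, hn3⟩ := (e1.and (e2.and e3)).exists
  -- As `z` is the midpoint of `z + v n` and `z - v n`, one of them has norm at least `‖z‖`.
  have hmid : 1 ≤ ‖z + v n‖ ∨ 1 ≤ ‖z + -v n‖ := by
    by_contra! h
    have h1 : z + z = (z + v n) + (z + -v n) := by abel
    have h2 : ‖z + z‖ = 2 * ‖z‖ := by rw [← two_smul ℝ z, norm_smul]; norm_num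
    have h3 := norm_add_le (z + v n) (z + -v n)
    rw [← h1, h2] at h3
    linarith
  rcases hmid with h | h
  · exact ⟨v n, h, (hv1 n).trans hn3, hn2, exists_dual_vanishing hn1⟩
  · refine ⟨-v n, h, ?_, fun f hf => ?_, exists_dual_vanishing fun w hw => ?_⟩
    · rw [← sub_eq_add_neg]; exact (hv2 n).trans hn3
    · rw [map_neg, abs_neg]; exact hn2 f hf
    · have := hn1 (-w) (F.neg_mem hw)
      have he : v n - -w = -(-v n - w) := by abel
      rwa [he, norm_neg] at this

/-- A reflexive space has no bounded sequence `x` with functionals `g n` that vanish on `x 0`, ...,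
`x n` and are uniformly positive on all later terms: a weak limit of `x` lies in the closed span of
the `x n`. -/
theorem not_exists_separated_sequence (hs : Function.Surjective (inclusionInDoubleDual ℝ X))
    {x : ℕ → X} {g : ℕ → StrongDual ℝ X} {C c : ℝ} (hc : 0 < c) (hx : ∀ n, ‖x n‖ ≤ C)
    (hg : ∀ n, ‖g n‖ ≤ 1) (h0 : ∀ n, ∀ j ≤ n, g n (x j) = 0)
    (h1 : ∀ n, ∀ j > n, c ≤ g n (x j)) : False := by
  obtain ⟨y, hy⟩ := exists_weak_limit_hyperfilter hs hx
  have hgy : ∀ n, c ≤ g n y := fun n => by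
    refine ge_of_tendsto (hy (g n)) (Nat.hyperfilter_le_atTop ?_)
    exact (eventually_gt_atTop n).mono fun j hj => h1 n j hj
  have hspan : ∀ w ∈ Submodule.span ℝ (Set.range x), ∃ n, ∀ m ≥ n, g m w = 0 := by
    intro w hw
    induction hw using Submodule.span_induction with
    | mem w hw =>
      obtain ⟨j, rfl⟩ := hw
      exact ⟨j, fun m hm => h0 m j hm⟩
    | zero => exact ⟨0, fun m _ => map_zero _⟩
    | add a b _ _ ha hb =>
      obtain ⟨n, hn⟩ := ha
      obtain ⟨k, hk⟩ := hb
      exact ⟨max n k, fun m hm => by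
        rw [map_add, hn m (le_of_max_le_left hm), hk m (le_of_max_le_right hm), add_zero]⟩
    | smul r a _ ha =>
      obtain ⟨n, hn⟩ := ha
      exact ⟨n, fun m hm => by rw [map_smul, hn m hm, smul_zero]⟩
  have hdist : ∀ w ∈ Submodule.span ℝ (Set.range x), c ≤ ‖y - w‖ := by
    intro w hw
    obtain ⟨n, hn⟩ := hspan w hw
    have := apply_le_norm_of_norm_le_one (hg n) (y - w)
    rw [map_sub, hn n le_rfl, sub_zero] at this
    exact (hgy n).trans this
  obtain ⟨f, -, hf0, hfy⟩ := exists_dual_vanishing hdist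
  have hlim := hy f
  simp only [fun n => hf0 (x n) (Submodule.subset_span ⟨n, rfl⟩)] at hlim
  have := tendsto_nhds_unique hlim tendsto_const_nhds
  linarith

/-- The data carried by the recursion: the current vector, a finite-dimensional subspace containing
all vectors so far, and the finite set of functionals chosen so far. -/
structure ChainState (X : Type*) [NormedAddCommGroup X] [NormedSpace ℝ X] where
  pt : X
  space : Submodule ℝ X
  finite : FiniteDimensional ℝ space
  mem : pt ∈ space
  one_le : 1 ≤ ‖pt‖
  duals : Finset (StrongDual ℝ X)

open scoped Classical in
/-- If uniform convexity failed, iterating `exists_step` would give a bounded sequence together with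
functionals as excluded by `not_exists_separated_sequence`. -/
theorem HasLocalContractions.uniformConvexSpace [CompleteSpace X] (H : HasLocalContractions X) :
    UniformConvexSpace X := by
  refine ⟨fun ε hε => ?_⟩
  by_contra hcon
  have huc : ∀ δ : ℝ, 0 < δ →
      ∃ x y : X, ‖x‖ = 1 ∧ ‖y‖ = 1 ∧ ε ≤ ‖x - y‖ ∧ 2 - δ < ‖x + y‖ := by
    intro δ hδ
    by_contra! h
    exact hcon ⟨δ, hδ, fun x hx y hy hxy => h x y hx hy hxy⟩
  obtain ⟨x₀, -, hx₀, -⟩ := huc 1 one_pos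
  have : Nontrivial X := ⟨x₀, 0, fun h => by simp [h] at hx₀⟩
  have hs := H.surjective_inclusionInDoubleDual
  obtain ⟨c, hc, hstep⟩ := H.exists_step hs hε huc
  -- At step `n` the norm and the old functionals change by at most `d n`, a summable sequence.
  let d : ℕ → ℝ := fun n => min 1 c * (1 / 2) ^ (n + 2)
  have hd : ∀ n, 0 < d n := fun n => by positivity
  have hnext : ∀ (n : ℕ) (s : ChainState X), ∃ t : ChainState X,
      ‖t.pt‖ ≤ ‖s.pt‖ + d n ∧ s.space ≤ t.space ∧ s.duals ⊆ t.duals ∧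
      (∀ f ∈ s.duals, f s.pt - d n ≤ f t.pt) ∧
      ∃ g ∈ t.duals, ‖g‖ ≤ 1 ∧ (∀ y ∈ s.space, g y = 0) ∧ c ≤ g t.pt := by
    intro n s
    have := s.finite
    obtain ⟨u, hu1, hu2, hu3, g, hg, hg0, hgu⟩ :=
      hstep s.pt s.one_le (d n) (hd n) s.duals s.space s.finite
    refine ⟨⟨s.pt + u, s.space ⊔ Submodule.span ℝ {s.pt + u}, inferInstance,
      (le_sup_right : _ ≤ s.space ⊔ _) (Submodule.mem_span_singleton_self _), hu1,
      insert g s.duals⟩, hu2, le_sup_left, Finset.subset_insert _ _, fun f hf => ?_,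
      g, Finset.mem_insert_self _ _, hg, hg0, ?_⟩
    · have := neg_le_of_abs_le (hu3 f hf)
      simp only [map_add]
      linarith
    · simp only [map_add, hg0 _ s.mem, zero_add]
      exact hgu
  choose next hn1 hn2 hn3 hn4 g hn5 hn6 hn7 hn8 using hnext
  let s : ℕ → ChainState X := fun n => Nat.rec
    ⟨x₀, Submodule.span ℝ {x₀}, inferInstance, Submodule.mem_span_singleton_self _, hx₀.ge, ∅⟩
    (fun n s => next n s) n
  have hs0 : (s 0).pt = x₀ := rfl
  have hsucc : ∀ n, s (n + 1) = next n (s n) := fun _ => rfl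
  have hspace : Monotone fun n => (s n).space := monotone_nat_of_le_succ fun n => hn2 n (s n)
  have hduals : Monotone fun n => (s n).duals := monotone_nat_of_le_succ fun n => hn3 n (s n)
  have hm1 : min 1 c ≤ 1 := min_le_left _ _
  have hm2 : min 1 c ≤ c := min_le_right _ _
  have hbound : ∀ n, ‖(s n).pt‖ ≤ 2 - (1 / 2) ^ (n + 1) := by
    intro n
    induction n with
    | zero => rw [hs0, hx₀]; norm_num
    | succ n ih =>
      have h1 : ‖(s (n + 1)).pt‖ ≤ ‖(s n).pt‖ + d n := hn1 n (s n)
      have h2 : d n ≤ (1 / 2) ^ (n + 2) := mul_le_of_le_one_left (by positivity) hm1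
      rw [pow_succ (1 / 2 : ℝ) (n + 1)] at h2 ⊢
      linarith
  have hlower : ∀ n k, c / 2 + c * (1 / 2) ^ (n + 1 + k + 1) ≤ g n (s n) (s (n + 1 + k)).pt := by
    intro n k
    induction k with
    | zero =>
      have h1 : c ≤ g n (s n) (s (n + 1)).pt := hn8 n (s n)
      have h2 : (1 / 2 : ℝ) ^ (n + 1 + 0 + 1) ≤ 1 / 2 := by
        rw [pow_succ]
        have : (1 / 2 : ℝ) ^ (n + 1 + 0) ≤ 1 := pow_le_one₀ (by norm_num) (by norm_num)
        linarith
      refine le_trans ?_ h1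
      nlinarith
    | succ k ih =>
      have hmem : g n (s n) ∈ (s (n + 1 + k)).duals :=
        hduals (by omega : n + 1 ≤ n + 1 + k) (hn5 n (s n))
      have h1 : g n (s n) (s (n + 1 + k)).pt - d (n + 1 + k) ≤ g n (s n) (s (n + 1 + k + 1)).pt :=
        hn4 _ _ _ hmem
      have h2 : d (n + 1 + k) ≤ c * (1 / 2) ^ (n + 1 + k + 2) :=
        mul_le_mul_of_nonneg_right hm2 (by positivity)
      have h3 : (1 / 2 : ℝ) ^ (n + 1 + k + 2) = (1 / 2) ^ (n + 1 + k + 1) * (1 / 2) := pow_succ _ _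
      change c / 2 + c * (1 / 2) ^ (n + 1 + k + 2) ≤ _
      rw [h3] at h2 ⊢
      change _ ≤ g n (s n) (s (n + 1 + k + 1)).pt
      linarith
  refine not_exists_separated_sequence hs (x := fun n => (s n).pt) (g := fun n => g n (s n))
    (C := 2) (c := c / 2) (by positivity) (fun n => ?_) (fun n => hn6 n (s n))
    (fun n j hj => hn7 n (s n) _ (hspace hj (s j).mem)) (fun n j hj => ?_)
  · have := hbound n
    have h2 : (0 : ℝ) < (1 / 2) ^ (n + 1) := by positivity
    linarith
  · obtain ⟨k, rfl⟩ := Nat.exists_eq_add_of_le (Nat.succ_le_of_lt hj)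
    have := hlower n k
    have h2 : 0 < c * (1 / 2 : ℝ) ^ (n + 1 + k + 1) := by positivity
    change _ ≤ g n (s n) (s (n + 1 + k)).pt
    linarith

end UniformConvex

/-! ### Micro-transitive norms -/

section MicroTransitive

/-- Orbits of a micro-transitive action are open, so they are everything on a connected space. -/
theorem IsMicroTransitiveAction.exists_smul_eq {G T : Type*} [Group G] [TopologicalSpace G]
    [IsTopologicalGroup G] [TopologicalSpace T] [MulAction G T] [ContinuousSMul G T]
    [PreconnectedSpace T] (h : IsMicroTransitiveAction G T) (x y : T) : ∃ g : G, g • x = y := by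
  have hnhds : ∀ z : T, MulAction.orbit G z ∈ 𝓝 z := fun z => by
    simpa [MulAction.orbit, Set.image_univ] using h z Set.univ Filter.univ_mem
  have hopen : ∀ z : T, IsOpen (MulAction.orbit G z) := fun z =>
    isOpen_iff_mem_nhds.mpr fun w hw => MulAction.orbit_eq_iff.mpr hw ▸ hnhds w
  have hclosed : IsClosed (MulAction.orbit G x) := by
    rw [← isOpen_compl_iff, isOpen_iff_mem_nhds]
    refine fun w hw => Filter.mem_of_superset (hnhds w) fun v hv hvx => hw ?_
    rw [← MulAction.orbit_eq_iff] at hv hvx ⊢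
    exact hv.symm.trans hvx
  have hy : y ∈ MulAction.orbit G x := by
    rw [IsClopen.eq_univ ⟨hclosed, hopen x⟩ ⟨x, MulAction.mem_orbit_self x⟩]
    trivial
  exact hy

open IsometryGroup in
/-- Uniformity follows from transitivity, since operator norm balls around the identity are
invariant under conjugation by isometries. In real dimension one the sphere is not connected, but
there nearby unit vectors coincide. -/
theorem MicroTransitiveNorm.uniformlyMicroSemitransitive {𝕜 X : Type*} [RCLike 𝕜]
    [NormedAddCommGroup X] [NormedSpace 𝕜 X] [NormedSpace ℝ X] (h : MicroTransitiveNorm 𝕜 X) :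
    UniformlyMicroSemitransitive 𝕜 X := by
  suffices H : ∀ ε : Set.Ioo (0 : ℝ) 2, ∃ β : ℝ, 0 < β ∧ ∀ x y : X, ‖x‖ = 1 → ‖y‖ = 1 →
      ‖x - y‖ < β →
        ∃ T : X →L[𝕜] X, ‖T‖ = 1 ∧ T x = y ∧ ‖T - ContinuousLinearMap.id 𝕜 X‖ < ε by
    choose β hβ hT using H
    exact ⟨β, hβ, hT⟩
  intro ε
  by_cases hne : ∃ x₀ : X, ‖x₀‖ = 1
  swap
  · exact ⟨1, one_pos, fun x _ hx => (hne ⟨x, hx⟩).elim⟩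
  obtain ⟨x₀, hx₀⟩ := hne
  have : Nontrivial X := ⟨x₀, 0, fun h => by simp [h] at hx₀⟩
  by_cases hrank : 1 < Module.rank ℝ X
  · have : PreconnectedSpace (Metric.sphere (0 : X) 1) :=
      Subtype.preconnectedSpace (isPreconnected_sphere hrank 0 1)
    let p₀ : Metric.sphere (0 : X) 1 := ⟨x₀, by simpa using hx₀⟩
    have hU : {g : X ≃ₗᵢ[𝕜] X | ‖toOp g - toOp 1‖ < ε} ∈ 𝓝 (1 : X ≃ₗᵢ[𝕜] X) := by
      have := continuous_toOp.continuousAt (x := (1 : X ≃ₗᵢ[𝕜] X)) (Metric.ball_mem_nhds _ ε.2.1)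
      simpa only [Filter.mem_map, Set.preimage, mem_ball_iff_norm] using this
    obtain ⟨β, hβ, hball⟩ := Metric.mem_nhds_iff.mp (h p₀ _ hU)
    refine ⟨β, hβ, fun x y hx hy hxy => ?_⟩
    obtain ⟨g, hg⟩ := IsMicroTransitiveAction.exists_smul_eq h p₀ ⟨x, by simpa using hx⟩
    have hgx : g x₀ = x := congrArg Subtype.val hg
    have hginv : ∀ v, g (g⁻¹ v) = v := fun v => g.apply_symm_apply v
    have hginv' : ∀ v, g⁻¹ (g v) = v := fun v => g.symm_apply_apply v
    have hmem : g⁻¹ • (⟨y, by simpa using hy⟩ : Metric.sphere (0 : X) 1) ∈ Metric.ball p₀ β := by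
      rw [Metric.mem_ball, Subtype.dist_eq, dist_eq_norm, coe_smul, ← g.norm_map, map_sub, hginv]
      change ‖y - g x₀‖ < β
      rwa [hgx, norm_sub_rev]
    obtain ⟨k, hk, hky⟩ := hball hmem
    replace hky : k x₀ = g⁻¹ y := congrArg Subtype.val hky
    refine ⟨toOp (g * k * g⁻¹), ?_, ?_, ?_⟩
    · exact (g * k * g⁻¹).toLinearIsometry.norm_toContinuousLinearMap
    · change g (k (g⁻¹ x)) = y
      rw [← hgx, hginv', hky, hginv]
    · refine lt_of_le_of_lt ?_ hk
      refine ContinuousLinearMap.opNorm_le_bound _ (norm_nonneg _) fun v => ?_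
      change ‖g (k (g⁻¹ v)) - v‖ ≤ _
      calc ‖g (k (g⁻¹ v)) - v‖ = ‖k (g⁻¹ v) - g⁻¹ v‖ := by
            rw [← g.norm_map (k (g⁻¹ v) - g⁻¹ v), map_sub, hginv]
        _ = ‖(toOp k - toOp 1 : X →L[𝕜] X) (g⁻¹ v)‖ := rfl
        _ ≤ ‖toOp k - toOp 1‖ * ‖g⁻¹ v‖ := ContinuousLinearMap.le_opNorm _ _
        _ = ‖toOp k - toOp 1‖ * ‖v‖ := by rw [(g⁻¹).norm_map v]
  · rw [not_lt, rank_le_one_iff] at hrank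
    obtain ⟨e, he⟩ := hrank
    refine ⟨1, one_pos, fun x y hx hy hxy => ⟨ContinuousLinearMap.id 𝕜 X,
      ContinuousLinearMap.norm_id, ?_, by simpa using ε.2.1⟩⟩
    obtain ⟨a, rfl⟩ := he x
    obtain ⟨b, rfl⟩ := he y
    have hab : |a| = |b| := by
      rw [norm_smul, Real.norm_eq_abs] at hx hy
      have : ‖e‖ ≠ 0 := fun h0 => by simp [h0] at hx
      exact mul_right_cancel₀ this (hx.trans hy.symm)
    rcases abs_eq_abs.mp hab with rfl | rfl
    · rfl
    · exfalso
      have : -b • e - b • e = -((2 : ℝ) • b • e) := by module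
      rw [this, norm_neg, norm_smul, hy] at hxy
      norm_num at hxy

end MicroTransitive

theorem mainTheorem1 (𝕜 : Type*) [RCLike 𝕜] (X : Type*) [NormedAddCommGroup X] [NormedSpace 𝕜 X]
    [NormedSpace ℝ X] [IsScalarTower ℝ 𝕜 X] [CompleteSpace X] :
    (MicroTransitiveNorm 𝕜 X → UniformlyMicroSemitransitive 𝕜 X) ∧
      (UniformlyMicroSemitransitive 𝕜 X → UniformlySmooth X ∧ UniformConvexSpace X) :=
  ⟨fun h => h.uniformlyMicroSemitransitive, fun h =>
    ⟨h.hasLocalContractions.uniformlySmooth, h.hasLocalContractions.uniformConvexSpace⟩⟩
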